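/- Let $k$ be a principal ideal domain, let $n, m_1, m_2 \ge 2$ be integers, and let $E \in GL_n(k)$, $F_1 \in GL_{m_1}(k)$, $F_2 \in GL_{m_2}(k)$. For $F \in GL_m(k)$ let $\mathcal B(E,F)$ be the $k$-algebra generated by $z_{ij}$ ($1 \le i \le n$, $1 \le j \le m$) subject to the matrix relations $F^{-1} z^t E z = I_m$ and $z F^{-1} z^t E = I_n$, where $z = (z_{ij})$. Let $\mathcal B(E)$ be the Hopf algebra generated by $a_{ij}$ ($1 \le i,j \le n$) subject to $E^{-1}a^tEa = I_n = aE^{-1}a^tE$, with $\Delta(a_{ij}) = \sum_l a_{il}\otimes a_{lj}$, $\varepsilon(a_{ij}) = \delta_{ij}$ and $S(a) = E^{-1}a^tE$. The algebra $\mathcal B(E,F)$ is a left $\mathcal B(E)$-comodule algebra via $\delta(z_{ij}) = \sum_l a_{il}\otimes z_{lj}$. For a Hopf algebra $H$ over $k$, a (left) $H$-Galois object is a left $H$-comodule algebra $Z$, with coaction $\delta: Z \to H \otimes Z$, that is faithfully flat over $k$, whose subalgebra of coinvariants $\{z \in Z : \delta(z) = 1\otimes z\}$ is $k$, and whose canonical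 map $Z\otimes Z\to H\otimes Z$, $z\otimes z'\mapsto \delta(z)(1\otimes z')$, is bijective. Two $H$-Galois objects are isomorphic if there is an isomorphism of $k$-algebras between them that commutes with the coactions. Assume that $\mathcal B(E,F_1)$ and $\mathcal B(E,F_2)$ are faithfully flat over $k$. Then $\mathcal B(E,F_1)$ and $\mathcal B(E,F_2)$ are $\mathcal B(E)$-Galois objects, and they are isomorphic as $\mathcal B(E)$-Galois objects if and only if $m_1 = m_2$ and there exists $P \in GL_{m_1}(k)$ such that $F_1 = P F_2 P^t$. -/

import Mathlib

open scoped TensorProduct MatrixGroups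

noncomputable section

/-! ### Galois objects over a Hopf algebra -/

/-- A left `H`-comodule algebra: a `k`-algebra `Z` with a left `H`-coaction `δ : Z → H ⊗ Z` that is
coassociative, counital and an algebra morphism. -/
class LeftComoduleAlgebra (k H Z : Type*) [CommRing k] [Ring H] [Bialgebra k H]
    [Ring Z] [Algebra k Z] where
  /-- the coaction -/
  coact : Z →ₐ[k] H ⊗[k] Z
  coassoc : (Algebra.TensorProduct.assoc k k k H H Z).toAlgHom.comp
      ((Algebra.TensorProduct.map (Bialgebra.comulAlgHom k H) (AlgHom.id k Z)).comp coact) =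
    (Algebra.TensorProduct.map (AlgHom.id k H) coact).comp coact
  counit_coact : (Algebra.TensorProduct.lid k Z).toAlgHom.comp
      ((Algebra.TensorProduct.map (Bialgebra.counitAlgHom k H) (AlgHom.id k Z)).comp coact) =
    AlgHom.id k Z

namespace LeftComoduleAlgebra

variable (k H Z Z' : Type*) [CommRing k] [Ring H]
  [Ring Z] [Algebra k Z] [Ring Z'] [Algebra k Z']

/-- The subalgebra of coinvariant elements, `{z | δ z = 1 ⊗ z}`. -/
def coinvariants [Bialgebra k H] [LeftComoduleAlgebra k H Z] : Subalgebra k Z :=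
  AlgHom.equalizer (coact : Z →ₐ[k] H ⊗[k] Z) Algebra.TensorProduct.includeRight

/-- The canonical map `Z ⊗ Z → H ⊗ Z`, `z ⊗ z' ↦ δ z * (1 ⊗ z')`. -/
def can [Bialgebra k H] [LeftComoduleAlgebra k H Z] : Z ⊗[k] Z →ₗ[k] H ⊗[k] Z :=
  LinearMap.mul' k (H ⊗[k] Z) ∘ₗ
    TensorProduct.map (coact : Z →ₐ[k] H ⊗[k] Z).toLinearMap
      (Algebra.TensorProduct.includeRight : Z →ₐ[k] H ⊗[k] Z).toLinearMap

/-- A (left) `H`-Galois object: an `H`-Galois extension of `k` (the coinvariants are `k` and the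
canonical map is bijective) that is faithfully flat over `k`. -/
structure IsGaloisObject [HopfAlgebra k H] [LeftComoduleAlgebra k H Z] : Prop where
  coinvariants_eq : coinvariants k H Z = ⊥
  can_bijective : Function.Bijective (can k H Z)
  faithfullyFlat : Module.FaithfullyFlat k Z

/-- `Z` and `Z'` are isomorphic as left `H`-comodule algebras over `k` (for `H`-Galois objects, this
is isomorphism of `H`-Galois objects: a `k`-algebra morphism is the identity on `k`). -/
def IsIsomorphic [Bialgebra k H] [LeftComoduleAlgebra k H Z] [LeftComoduleAlgebra k H Z'] : Prop :=
  ∃ φ : Z ≃ₐ[k] Z', ∀ z : Z,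
    (coact (φ z) : H ⊗[k] Z') =
      Algebra.TensorProduct.map (AlgHom.id k H) φ.toAlgHom (coact z : H ⊗[k] Z)

end LeftComoduleAlgebra

/-! ### The algebras `B(E, F)` and the Hopf algebras `B(E)` -/

namespace BilinearForm

/-- A matrix of scalars, seen as a matrix over a `k`-algebra `A`. -/
abbrev scal {k : Type*} [CommRing k] (A : Type*) [Ring A] [Algebra k A] {p q : ℕ}
    (M : Matrix (Fin p) (Fin q) k) : Matrix (Fin p) (Fin q) A :=
  M.map (algebraMap k A)

/-- The relations `F⁻¹ zᵗ E z = I` and `z F⁻¹ zᵗ E = I` for a matrix `z` over a `k`-algebra. -/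
structure Relations {k : Type*} [CommRing k] {n m : ℕ} (E : GL (Fin n) k) (F : GL (Fin m) k)
    {A : Type*} [Ring A] [Algebra k A] (z : Matrix (Fin n) (Fin m) A) : Prop where
  left : scal A (F⁻¹).val * z.transpose * scal A E.val * z = 1
  right : z * scal A (F⁻¹).val * z.transpose * scal A E.val = 1

/-- The matrix of generators of the free algebra on variables `z i j`. -/
def freeMat (k : Type*) [CommRing k] (n m : ℕ) :
    Matrix (Fin n) (Fin m) (FreeAlgebra k (Fin n × Fin m)) :=
  Matrix.of fun i j => FreeAlgebra.ι k (i, j)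

/-- The defining relations of `B(E, F)`, entry by entry. -/
inductive Rel {k : Type*} [CommRing k] {n m : ℕ} (E : GL (Fin n) k) (F : GL (Fin m) k) :
    FreeAlgebra k (Fin n × Fin m) → FreeAlgebra k (Fin n × Fin m) → Prop
  | left (i j : Fin m) : Rel E F
      ((scal (FreeAlgebra k (Fin n × Fin m)) (F⁻¹).val *
        (freeMat k n m).transpose * scal (FreeAlgebra k (Fin n × Fin m)) E.val * freeMat k n m) i j)
      ((1 : Matrix (Fin m) (Fin m) (FreeAlgebra k (Fin n × Fin m))) i j)
  | right (i j : Fin n) : Rel E F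
      ((freeMat k n m * scal (FreeAlgebra k (Fin n × Fin m)) (F⁻¹).val *
        (freeMat k n m).transpose * scal (FreeAlgebra k (Fin n × Fin m)) E.val) i j)
      ((1 : Matrix (Fin n) (Fin n) (FreeAlgebra k (Fin n × Fin m))) i j)

/-- The `k`-algebra `B(E, F)` generated by `z i j`, `i < n`, `j < m`, with the relations
`F⁻¹ zᵗ E z = I` and `z F⁻¹ zᵗ E = I`. -/
def BAlg {k : Type*} [CommRing k] {n m : ℕ} (E : GL (Fin n) k) (F : GL (Fin m) k) : Type _ :=
  RingQuot (Rel E F)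

section

variable {k : Type*} [CommRing k] {n m p : ℕ}

instance (E : GL (Fin n) k) (F : GL (Fin m) k) : Ring (BAlg E F) :=
  inferInstanceAs (Ring (RingQuot (Rel E F)))

instance (E : GL (Fin n) k) (F : GL (Fin m) k) : Algebra k (BAlg E F) :=
  inferInstanceAs (Algebra k (RingQuot (Rel E F)))

/-- The `k`-algebra `B(E)` generated by `a i j`, `i, j < n`, with the relations
`E⁻¹ aᵗ E a = I = a E⁻¹ aᵗ E`; this is the presentation of `B(E, F)` for `F = E`. -/
abbrev BHopf (E : GL (Fin n) k) : Type _ := BAlg E E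

/-- The quotient map from the free algebra. -/
def BAlg.mk (E : GL (Fin n) k) (F : GL (Fin m) k) :
    FreeAlgebra k (Fin n × Fin m) →ₐ[k] BAlg E F :=
  RingQuot.mkAlgHom k (Rel E F)

/-- The matrix of generators of `B(E, F)`. -/
def gen (E : GL (Fin n) k) (F : GL (Fin m) k) : Matrix (Fin n) (Fin m) (BAlg E F) :=
  Matrix.of fun i j => BAlg.mk E F (FreeAlgebra.ι k (i, j))

/-! Helper facts on matrices over `k`-algebras -/

theorem map_scal {A B : Type*} [Ring A] [Algebra k A] [Ring B] [Algebra k B] (f : A →ₐ[k] B)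
    {p q : ℕ} (M : Matrix (Fin p) (Fin q) k) : (scal A M).map f = scal B M := by
  ext i j; simp [scal]

theorem scal_mul {A : Type*} [Ring A] [Algebra k A] {p q r : ℕ}
    (M : Matrix (Fin p) (Fin q) k) (N : Matrix (Fin q) (Fin r) k) :
    scal A (M * N) = scal A M * scal A N := by
  simp [scal, Matrix.map_mul]

theorem scal_one {A : Type*} [Ring A] [Algebra k A] {p : ℕ} :
    scal A (1 : Matrix (Fin p) (Fin p) k) = 1 := by
  simp [scal]

theorem scal_mul_inv {A : Type*} [Ring A] [Algebra k A] (E : GL (Fin n) k) :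
    scal A E.val * scal A (E⁻¹).val = 1 := by
  rw [← scal_mul, ← Units.val_mul, mul_inv_cancel, Units.val_one, scal_one]

theorem scal_inv_mul {A : Type*} [Ring A] [Algebra k A] (E : GL (Fin n) k) :
    scal A (E⁻¹).val * scal A E.val = 1 := by
  rw [← scal_mul, ← Units.val_mul, inv_mul_cancel, Units.val_one, scal_one]

theorem transpose_mul_of_commute {A : Type*} [Ring A] {p q r : ℕ}
    (M : Matrix (Fin p) (Fin q) A) (N : Matrix (Fin q) (Fin r) A)
    (h : ∀ i j l, Commute (M i j) (N j l)) :
    (M * N).transpose = N.transpose * M.transpose := by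
  ext i j
  simp only [Matrix.transpose_apply, Matrix.mul_apply]
  exact Finset.sum_congr rfl fun x _ => (h j x i).eq

theorem transpose_scal_mul {A : Type*} [Ring A] [Algebra k A] {p q r : ℕ}
    (M : Matrix (Fin p) (Fin q) k) (N : Matrix (Fin q) (Fin r) A) :
    (scal A M * N).transpose = N.transpose * scal A M.transpose :=
  transpose_mul_of_commute _ _ fun i j _ => Algebra.commutes (M i j) _

theorem transpose_mul_scal {A : Type*} [Ring A] [Algebra k A] {p q r : ℕ}
    (M : Matrix (Fin p) (Fin q) A) (N : Matrix (Fin q) (Fin r) k) :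
    (M * scal A N).transpose = scal A N.transpose * M.transpose :=
  transpose_mul_of_commute _ _ fun _ j l => (Algebra.commutes (N j l) _).symm

theorem Relations.map {E : GL (Fin n) k} {F : GL (Fin m) k} {A B : Type*} [Ring A] [Algebra k A]
    [Ring B] [Algebra k B] {z : Matrix (Fin n) (Fin m) A} (h : Relations E F z) (f : A →ₐ[k] B) :
    Relations E F (z.map f) := by
  constructor
  · have := congrArg (fun M => M.map f) h.left
    simpa only [Matrix.map_mul, map_scal, Matrix.transpose_map,
      Matrix.map_one f (map_zero f) (map_one f)] using this
  · have := congrArg (fun M => M.map f) h.right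
    simpa only [Matrix.map_mul, map_scal, Matrix.transpose_map,
      Matrix.map_one f (map_zero f) (map_one f)] using this

theorem Relations.transpose_mul_mul {E : GL (Fin n) k} {F : GL (Fin m) k} {A : Type*} [Ring A]
    [Algebra k A] {z : Matrix (Fin n) (Fin m) A} (h : Relations E F z) :
    z.transpose * scal A E.val * z = scal A F.val := by
  have := congrArg (fun M => scal A F.val * M) h.left
  simpa only [← mul_assoc, ← Matrix.mul_assoc, scal_mul_inv, Matrix.one_mul, Matrix.mul_one]
    using this

theorem Relations.mul_mul_transpose {E : GL (Fin n) k} {F : GL (Fin m) k} {A : Type*} [Ring A]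
    [Algebra k A] {z : Matrix (Fin n) (Fin m) A} (h : Relations E F z) :
    z * scal A (F⁻¹).val * z.transpose = scal A (E⁻¹).val := by
  have := congrArg (fun M => M * scal A (E⁻¹).val) h.right
  simpa only [Matrix.mul_assoc, scal_mul_inv, Matrix.one_mul, Matrix.mul_one] using this

theorem Relations.mul {E : GL (Fin n) k} {G : GL (Fin p) k} {F : GL (Fin m) k} {A : Type*}
    [Ring A] [Algebra k A] {z : Matrix (Fin n) (Fin p) A} {w : Matrix (Fin p) (Fin m) A}
    (hz : Relations E G z) (hw : Relations G F w) (h : ∀ i j l, Commute (z i j) (w j l)) :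
    Relations E F (z * w) := by
  constructor
  · calc scal A (F⁻¹).val * (z * w).transpose * scal A E.val * (z * w)
        = scal A (F⁻¹).val * w.transpose * (z.transpose * scal A E.val * z) * w := by
          simp only [transpose_mul_of_commute z w h, Matrix.mul_assoc]
      _ = 1 := by rw [hz.transpose_mul_mul, hw.left]
  · calc z * w * scal A (F⁻¹).val * (z * w).transpose * scal A E.val
        = z * (w * scal A (F⁻¹).val * w.transpose) * z.transpose * scal A E.val := by
          simp only [transpose_mul_of_commute z w h, Matrix.mul_assoc]
      _ = 1 := by rw [hw.mul_mul_transpose, hz.right]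

/-- The transpose of a matrix, with entries in the opposite ring. -/
def opT {A : Type*} {p q : ℕ} (M : Matrix (Fin p) (Fin q) A) : Matrix (Fin q) (Fin p) Aᵐᵒᵖ :=
  M.transpose.map MulOpposite.op

theorem opT_mul {A : Type*} [Ring A] {p q r : ℕ}
    (M : Matrix (Fin p) (Fin q) A) (N : Matrix (Fin q) (Fin r) A) :
    opT (M * N) = opT N * opT M := by
  ext i j
  simp [opT, Matrix.mul_apply, Finset.op_sum]

theorem opT_scal {A : Type*} [Ring A] [Algebra k A] {p q : ℕ} (M : Matrix (Fin p) (Fin q) k) :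
    opT (scal A M) = scal Aᵐᵒᵖ M.transpose := by
  ext i j; simp [opT, scal, MulOpposite.algebraMap_apply]

theorem opT_one {A : Type*} [Ring A] {p : ℕ} :
    opT (1 : Matrix (Fin p) (Fin p) A) = 1 := by
  ext i j
  by_cases h : i = j
  · subst h; simp [opT]
  · simp [opT, h]

theorem relations_antipode {E : GL (Fin n) k} {A : Type*} [Ring A] [Algebra k A]
    {a : Matrix (Fin n) (Fin n) A} (h : Relations E E a) :
    Relations E E ((scal A (E⁻¹).val * a.transpose * scal A E.val).map MulOpposite.op) := by
  set w := scal A (E⁻¹).val * a.transpose * scal A E.val with hw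
  have hwa : w * a = 1 := h.left
  have haw : a * w = 1 := by
    rw [hw, ← Matrix.mul_assoc, ← Matrix.mul_assoc]; exact h.right
  have hwt : w.transpose = scal A E.val.transpose * (a * scal A (E⁻¹).val.transpose) := by
    rw [hw, transpose_mul_scal, transpose_scal_mul, Matrix.transpose_transpose]
  have e1 : w.map MulOpposite.op = opT w.transpose := by simp [opT]
  have e2 : (w.map MulOpposite.op).transpose = opT w := by simp [opT, Matrix.transpose_map]
  have e3 : ∀ M : Matrix (Fin n) (Fin n) k, scal Aᵐᵒᵖ M = opT (scal A M.transpose) := by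
    intro M; rw [opT_scal, Matrix.transpose_transpose]
  have i1 : scal A (E⁻¹).val.transpose * scal A E.val.transpose = 1 := by
    rw [← scal_mul, ← Matrix.transpose_mul, ← Units.val_mul, mul_inv_cancel, Units.val_one,
      Matrix.transpose_one, scal_one]
  have i2 : scal A E.val.transpose * scal A (E⁻¹).val.transpose = 1 := by
    rw [← scal_mul, ← Matrix.transpose_mul, ← Units.val_mul, inv_mul_cancel, Units.val_one,
      Matrix.transpose_one, scal_one]
  constructor
  · rw [e2, e1, e3, e3, ← opT_mul, ← opT_mul, ← opT_mul, ← opT_one]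
    congr 1
    calc w.transpose * (scal A E.val.transpose * (w * scal A (E⁻¹).val.transpose))
        = scal A E.val.transpose * (a * ((scal A (E⁻¹).val.transpose * scal A E.val.transpose)
            * (w * scal A (E⁻¹).val.transpose))) := by
          rw [hwt]; simp only [Matrix.mul_assoc]
      _ = scal A E.val.transpose * ((a * w) * scal A (E⁻¹).val.transpose) := by
          rw [i1, Matrix.one_mul, Matrix.mul_assoc a w]
      _ = 1 := by rw [haw, Matrix.one_mul, i2]
  · rw [e2, e1, e3, e3, ← opT_mul, ← opT_mul, ← opT_mul, ← opT_one]
    congr 1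
    calc scal A E.val.transpose * (w * (scal A (E⁻¹).val.transpose * w.transpose))
        = scal A E.val.transpose * (w * ((scal A (E⁻¹).val.transpose * scal A E.val.transpose)
            * (a * scal A (E⁻¹).val.transpose))) := by
          rw [hwt]; simp only [Matrix.mul_assoc]
      _ = scal A E.val.transpose * ((w * a) * scal A (E⁻¹).val.transpose) := by
          rw [i1, Matrix.one_mul, Matrix.mul_assoc w a]
      _ = 1 := by rw [hwa, Matrix.one_mul, i2]

/-! The universal property of `B(E, F)` -/

theorem gen_relations (E : GL (Fin n) k) (F : GL (Fin m) k) : Relations E F (gen E F) := by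
  have hg : gen E F = (freeMat k n m).map (BAlg.mk E F) := rfl
  have hrel : ∀ x y, Rel E F x y → BAlg.mk E F x = BAlg.mk E F y :=
    fun x y h => RingQuot.mkAlgHom_rel k h
  constructor
  · ext i j
    have := hrel _ _ (Rel.left (E := E) (F := F) i j)
    rw [← Matrix.map_apply (f := BAlg.mk E F), ← Matrix.map_apply (f := BAlg.mk E F)] at this
    simpa only [Matrix.map_mul, map_scal, Matrix.transpose_map, ← hg,
      Matrix.map_one (BAlg.mk E F) (map_zero _) (map_one _)] using this
  · ext i j
    have := hrel _ _ (Rel.right (E := E) (F := F) i j)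
    rw [← Matrix.map_apply (f := BAlg.mk E F), ← Matrix.map_apply (f := BAlg.mk E F)] at this
    simpa only [Matrix.map_mul, map_scal, Matrix.transpose_map, ← hg,
      Matrix.map_one (BAlg.mk E F) (map_zero _) (map_one _)] using this

theorem lift_aux {E : GL (Fin n) k} {F : GL (Fin m) k} {A : Type*} [Ring A] [Algebra k A]
    {z : Matrix (Fin n) (Fin m) A} (h : Relations E F z) ⦃x y : FreeAlgebra k (Fin n × Fin m)⦄
    (hxy : Rel E F x y) :
    FreeAlgebra.lift k (fun ij : Fin n × Fin m => z ij.1 ij.2) x =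
      FreeAlgebra.lift k (fun ij : Fin n × Fin m => z ij.1 ij.2) y := by
  set f := FreeAlgebra.lift k (fun ij : Fin n × Fin m => z ij.1 ij.2) with hf
  have hg : (freeMat k n m).map f = z := by ext i j; simp [freeMat, hf]
  cases hxy with
  | left i j =>
    rw [← Matrix.map_apply (f := f), ← Matrix.map_apply (f := f)]
    simp only [Matrix.map_mul, map_scal, Matrix.transpose_map, hg,
      Matrix.map_one f (map_zero _) (map_one _), h.left]
  | right i j =>
    rw [← Matrix.map_apply (f := f), ← Matrix.map_apply (f := f)]
    simp only [Matrix.map_mul, map_scal, Matrix.transpose_map, hg,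
      Matrix.map_one f (map_zero _) (map_one _), h.right]

/-- The algebra morphism from `B(E, F)` given by a matrix satisfying the relations. -/
def BAlg.lift {E : GL (Fin n) k} {F : GL (Fin m) k} {A : Type*} [Ring A] [Algebra k A]
    (z : Matrix (Fin n) (Fin m) A) (h : Relations E F z) : BAlg E F →ₐ[k] A :=
  RingQuot.liftAlgHom k
    ⟨FreeAlgebra.lift k (fun ij : Fin n × Fin m => z ij.1 ij.2), lift_aux h⟩

@[simp]
theorem BAlg.lift_gen {E : GL (Fin n) k} {F : GL (Fin m) k} {A : Type*} [Ring A] [Algebra k A]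
    (z : Matrix (Fin n) (Fin m) A) (h : Relations E F z) (i : Fin n) (j : Fin m) :
    BAlg.lift z h (gen E F i j) = z i j := by
  change RingQuot.liftAlgHom k _ (RingQuot.mkAlgHom k (Rel E F) _) = _
  rw [RingQuot.liftAlgHom_mkAlgHom_apply, FreeAlgebra.lift_ι_apply]

theorem BAlg.hom_ext {E : GL (Fin n) k} {F : GL (Fin m) k} {A : Type*} [Ring A] [Algebra k A]
    {f g : BAlg E F →ₐ[k] A} (h : ∀ i j, f (gen E F i j) = g (gen E F i j)) : f = g := by
  apply RingQuot.ringQuot_ext' k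
  ext ⟨i, j⟩
  exact h i j

theorem BAlg.induction {E : GL (Fin n) k} {F : GL (Fin m) k} {C : BAlg E F → Prop}
    (hs : ∀ r, C (algebraMap k _ r)) (hg : ∀ i j, C (gen E F i j))
    (hm : ∀ x y, C x → C y → C (x * y)) (ha : ∀ x y, C x → C y → C (x + y)) (x : BAlg E F) :
    C x := by
  obtain ⟨y, rfl⟩ : ∃ y, BAlg.mk E F y = x := RingQuot.mkAlgHom_surjective k (Rel E F) x
  induction y using FreeAlgebra.induction with
  | grade0 r => rw [AlgHom.commutes]; exact hs r
  | grade1 ij => exact hg ij.1 ij.2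
  | mul a b iha ihb => rw [map_mul]; exact hm _ _ iha ihb
  | add a b iha ihb => rw [map_add]; exact ha _ _ iha ihb

/-! The coaction, the comultiplication, the counit and the antipode -/

theorem relations_tensor (E : GL (Fin n) k) (G : GL (Fin p) k) (F : GL (Fin m) k) :
    Relations E F (Matrix.of fun i j =>
      ∑ l, gen E G i l ⊗ₜ[k] gen G F l j : Matrix _ _ (BAlg E G ⊗[k] BAlg G F)) := by
  have := ((gen_relations E G).map
      (Algebra.TensorProduct.includeLeft : BAlg E G →ₐ[k] BAlg E G ⊗[k] BAlg G F)).mul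
    ((gen_relations G F).map
      (Algebra.TensorProduct.includeRight : BAlg G F →ₐ[k] BAlg E G ⊗[k] BAlg G F))
    (fun i j l => by simp [Commute, SemiconjBy])
  have e : (Matrix.of fun i j =>
      ∑ l, gen E G i l ⊗ₜ[k] gen G F l j : Matrix _ _ (BAlg E G ⊗[k] BAlg G F)) =
      (gen E G).map (Algebra.TensorProduct.includeLeft : BAlg E G →ₐ[k] BAlg E G ⊗[k] BAlg G F) *
        (gen G F).map
          (Algebra.TensorProduct.includeRight : BAlg G F →ₐ[k] BAlg E G ⊗[k] BAlg G F) := by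
    ext i j
    simp [Matrix.mul_apply]
  rw [e]
  exact this

/-- The algebra morphism `B(E, F) → B(E, G) ⊗ B(G, F)`, `z i j ↦ ∑ l, z i l ⊗ z l j`. -/
def cocomp (E : GL (Fin n) k) (G : GL (Fin p) k) (F : GL (Fin m) k) :
    BAlg E F →ₐ[k] BAlg E G ⊗[k] BAlg G F :=
  BAlg.lift (Matrix.of fun i j => ∑ l, gen E G i l ⊗ₜ[k] gen G F l j) (relations_tensor E G F)

@[simp]
theorem cocomp_gen (E : GL (Fin n) k) (G : GL (Fin p) k) (F : GL (Fin m) k) (i : Fin n)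
    (j : Fin m) : cocomp E G F (gen E F i j) = ∑ l, gen E G i l ⊗ₜ[k] gen G F l j := by
  simp [cocomp]

theorem relations_one (E : GL (Fin n) k) : Relations E E (1 : Matrix (Fin n) (Fin n) k) := by
  constructor
  · rw [Matrix.transpose_one, Matrix.mul_one, Matrix.mul_one, scal_inv_mul]
  · rw [Matrix.transpose_one, Matrix.mul_one, Matrix.one_mul, scal_inv_mul]

/-- The counit of `B(E)`: `ε (a i j) = δ_{ij}`. -/
def counitHom (E : GL (Fin n) k) : BHopf E →ₐ[k] k := BAlg.lift 1 (relations_one E)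

@[simp]
theorem counitHom_gen (E : GL (Fin n) k) (i j : Fin n) :
    counitHom E (gen E E i j) = (1 : Matrix (Fin n) (Fin n) k) i j := by
  simp [counitHom]

theorem cocomp_coassoc (E : GL (Fin n) k) (F : GL (Fin m) k) :
    (Algebra.TensorProduct.assoc k k k (BHopf E) (BHopf E) (BAlg E F)).toAlgHom.comp
      ((Algebra.TensorProduct.map (cocomp E E E) (AlgHom.id k (BAlg E F))).comp
        (cocomp E E F)) =
    (Algebra.TensorProduct.map (AlgHom.id k (BHopf E)) (cocomp E E F)).comp (cocomp E E F) := by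
  apply BAlg.hom_ext
  intro i j
  simp only [AlgHom.comp_apply, cocomp_gen, map_sum, Algebra.TensorProduct.map_tmul,
    AlgHom.id_apply, TensorProduct.sum_tmul, TensorProduct.tmul_sum]
  rw [Finset.sum_comm]
  simp

theorem cocomp_counit_left (E : GL (Fin n) k) (F : GL (Fin m) k) :
    (Algebra.TensorProduct.map (counitHom E) (AlgHom.id k (BAlg E F))).comp (cocomp E E F) =
      (Algebra.TensorProduct.lid k (BAlg E F)).symm.toAlgHom := by
  apply BAlg.hom_ext
  intro i j
  simp [Matrix.one_apply, TensorProduct.ite_tmul]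

theorem cocomp_counit_right (E : GL (Fin n) k) :
    (Algebra.TensorProduct.map (AlgHom.id k (BHopf E)) (counitHom E)).comp (cocomp E E E) =
      (Algebra.TensorProduct.rid k k (BHopf E)).symm.toAlgHom := by
  apply BAlg.hom_ext
  intro i j
  simp [Matrix.one_apply, TensorProduct.tmul_ite]

/-- The bialgebra `B(E)`: `Δ (a i j) = ∑ l, a i l ⊗ a l j`, `ε (a i j) = δ_{ij}`. -/
instance (E : GL (Fin n) k) : Bialgebra k (BHopf E) :=
  Bialgebra.ofAlgHom (cocomp E E E) (counitHom E) (cocomp_coassoc E E) (cocomp_counit_left E E)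
    (cocomp_counit_right E)

/-- The antipode as an algebra morphism to the opposite algebra: `S(a) = E⁻¹ aᵗ E`. -/
def antipodeHom (E : GL (Fin n) k) : BHopf E →ₐ[k] (BHopf E)ᵐᵒᵖ :=
  BAlg.lift _ (relations_antipode (gen_relations E E))

/-- The antipode of `B(E)`. -/
def antipodeMap (E : GL (Fin n) k) : BHopf E →ₗ[k] BHopf E :=
  (MulOpposite.opLinearEquiv k).symm.toLinearMap ∘ₗ (antipodeHom E).toLinearMap

theorem antipodeMap_gen (E : GL (Fin n) k) (i j : Fin n) : antipodeMap E (gen E E i j) =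
    (scal (BHopf E) (E⁻¹).val * (gen E E).transpose * scal (BHopf E) E.val) i j := by
  simp only [antipodeMap, antipodeHom, LinearMap.comp_apply, AlgHom.toLinearMap_apply,
    BAlg.lift_gen, Matrix.map_apply, LinearEquiv.coe_coe, MulOpposite.coe_opLinearEquiv_symm,
    MulOpposite.unop_op]

theorem antipodeMap_mul (E : GL (Fin n) k) (x y : BHopf E) :
    antipodeMap E (x * y) = antipodeMap E y * antipodeMap E x := by
  simp [antipodeMap]

theorem antipodeMap_algebraMap (E : GL (Fin n) k) (r : k) :
    antipodeMap E (algebraMap k _ r) = algebraMap k _ r := by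
  simp [antipodeMap, MulOpposite.algebraMap_apply]

theorem antipode_left (E : GL (Fin n) k) (x : BHopf E) :
    LinearMap.mul' k (BHopf E) ((antipodeMap E).rTensor (BHopf E) (cocomp E E E x)) =
      algebraMap k _ (counitHom E x) := by
  set f := LinearMap.mul' k (BHopf E) ∘ₗ (antipodeMap E).rTensor (BHopf E) with hf
  have h1 : ∀ t s₁ s₂, f (t * s₁ ⊗ₜ s₂) = antipodeMap E s₁ * f t * s₂ := by
    intro t s₁ s₂
    induction t with
    | zero => simp
    | tmul a b => simp [hf, antipodeMap_mul, mul_assoc]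
    | add a b ha hb => rw [add_mul, map_add, ha, hb, map_add, mul_add, add_mul]
  have h2 : ∀ t s c, f t = algebraMap k _ c → f (t * s) = algebraMap k _ c * f s := by
    intro t s c htc
    induction s with
    | zero => simp
    | tmul a b =>
      rw [h1, htc, ← Algebra.commutes c (antipodeMap E a), mul_assoc]
      simp [hf]
    | add a b ha hb => rw [mul_add, map_add, ha, hb, map_add, mul_add]
  change f (cocomp E E E x) = _
  induction x using BAlg.induction with
  | hs r =>
    rw [AlgHom.commutes, AlgHom.commutes, Algebra.TensorProduct.algebraMap_apply]
    simp [hf, antipodeMap_algebraMap]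
  | hg i j =>
    have := congrFun (congrFun (gen_relations E E).left i) j
    rw [Matrix.mul_apply] at this
    simp only [cocomp_gen, map_sum, hf, LinearMap.comp_apply, LinearMap.rTensor_tmul,
      LinearMap.mul'_apply, antipodeMap_gen, this, counitHom_gen]
    by_cases h : i = j
    · subst h; simp
    · simp [h]
  | hm x y hx hy => rw [map_mul, h2 _ _ _ hx, hy, map_mul, map_mul]
  | ha x y hx hy => rw [map_add, map_add, hx, hy, map_add, map_add]

theorem antipode_right (E : GL (Fin n) k) (x : BHopf E) :
    LinearMap.mul' k (BHopf E) ((antipodeMap E).lTensor (BHopf E) (cocomp E E E x)) =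
      algebraMap k _ (counitHom E x) := by
  set f := LinearMap.mul' k (BHopf E) ∘ₗ (antipodeMap E).lTensor (BHopf E) with hf
  have h1 : ∀ s t₁ t₂, f (t₁ ⊗ₜ t₂ * s) = t₁ * f s * antipodeMap E t₂ := by
    intro s t₁ t₂
    induction s with
    | zero => simp
    | tmul a b => simp [hf, antipodeMap_mul, mul_assoc]
    | add a b ha hb => rw [mul_add, map_add, ha, hb, map_add, mul_add, add_mul]
  have h2 : ∀ t s c, f s = algebraMap k _ c → f (t * s) = f t * algebraMap k _ c := by
    intro t s c hsc
    induction t with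
    | zero => simp
    | tmul a b =>
      rw [h1, hsc, mul_assoc, Algebra.commutes c (antipodeMap E b), ← mul_assoc]
      simp [hf]
    | add a b ha hb => rw [add_mul, map_add, ha, hb, map_add, add_mul]
  change f (cocomp E E E x) = _
  induction x using BAlg.induction with
  | hs r =>
    rw [AlgHom.commutes, AlgHom.commutes, Algebra.TensorProduct.algebraMap_apply]
    have := antipodeMap_algebraMap E 1
    simp only [map_one] at this
    simp [hf, this]
  | hg i j =>
    have := congrFun (congrFun (gen_relations E E).right i) j
    rw [Matrix.mul_assoc, Matrix.mul_assoc, Matrix.mul_apply] at this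
    simp only [cocomp_gen, map_sum, hf, LinearMap.comp_apply, LinearMap.lTensor_tmul,
      LinearMap.mul'_apply, antipodeMap_gen, Matrix.mul_assoc, this, counitHom_gen]
    by_cases h : i = j
    · subst h; simp
    · simp [h]
  | hm x y hx hy => rw [map_mul, h2 _ _ _ hy, hx, map_mul, map_mul]
  | ha x y hx hy => rw [map_add, map_add, hx, hy, map_add, map_add]

/-- The Hopf algebra `B(E)`, with antipode `S(a) = E⁻¹ aᵗ E`. -/
instance (E : GL (Fin n) k) : HopfAlgebra k (BHopf E) where
  antipode := antipodeMap E
  mul_antipode_rTensor_comul := LinearMap.ext (antipode_left E)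
  mul_antipode_lTensor_comul := LinearMap.ext (antipode_right E)

/-- The left `B(E)`-comodule algebra `B(E, F)`: `δ (z i j) = ∑ l, a i l ⊗ z l j`. -/
instance (E : GL (Fin n) k) (F : GL (Fin m) k) :
    LeftComoduleAlgebra k (BHopf E) (BAlg E F) where
  coact := cocomp E E F
  coassoc := cocomp_coassoc E F
  counit_coact := by
    change (Algebra.TensorProduct.lid k (BAlg E F)).toAlgHom.comp
      ((Algebra.TensorProduct.map (counitHom E) (AlgHom.id k (BAlg E F))).comp
        (cocomp E E F)) = _
    rw [cocomp_counit_left]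
    ext x
    simp

end

end BilinearForm

end

/-! Write `z` for the generators of Z = B(E, F), `w = F⁻¹ zᵗ E` for the inverse matrix, and `a` for
the generators of B(E), so that δ(z) = a z.

Galois property: there is an algebra morphism B(E) → Z ⊗ Zᵒᵖ sending a_ij to ∑ z_il ⊗ w_lj.
Multiplying its second leg into Z gives the inverse of the canonical map; on generators both
composites reduce to z w = 1 and w z = 1 (`can_translation`, `canInv_cocomp`). If x is coinvariant,
then x ⊗ 1 and 1 ⊗ x have the same image under the canonical map, hence are equal, and faithfully
flat descent makes x a scalar (`coinvariants_eq_bot`).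

Classification: a colinear isomorphism B(E, G) → B(E, F) sends the generators to a matrix u with
δ(u) = a u. Then w u is coinvariant, because a cancels by aᵗ E a = E, so u = z P with P a scalar
matrix (`exists_eq_gen_mul_scal`). The inverse isomorphism provides the inverse of P, and uᵗ E u = G
becomes Pᵗ F P = G. Conversely, a congruence between F and G makes z ↦ z Pᵗ an isomorphism, colinear
because δ acts on rows and Pᵗ on columns. -/

noncomputable section

/-! ### Faithfully flat descent and coinvariants. -/

namespace LeftComoduleAlgebra

variable {k H Z : Type*} [CommRing k] [Ring H] [Ring Z] [Algebra k Z]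

theorem can_tmul [Bialgebra k H] [LeftComoduleAlgebra k H Z] (z x : Z) :
    can k H Z (z ⊗ₜ x) = coact z * (1 ⊗ₜ x : H ⊗[k] Z) := by
  simp [can]

/-- If r dies in Z, then by flatness (r) ⊗ Z embeds in k ⊗ Z with zero image, so faithful flatness
forces (r) = 0. -/
theorem algebraMap_injective_of_faithfullyFlat [Module.FaithfullyFlat k Z] :
    Function.Injective (algebraMap k Z) := by
  refine (injective_iff_map_eq_zero _).2 fun r hr => ?_
  let N : Submodule k k := Submodule.span k {r}
  have hsub : Subsingleton (N ⊗[k] Z) := by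
    refine subsingleton_of_forall_eq 0 fun t => ?_
    induction t with
    | zero => rfl
    | add a b ha hb => rw [ha, hb, add_zero]
    | tmul c z =>
      apply Module.Flat.rTensor_preserves_injective_linearMap (M := Z) N.subtype
        N.injective_subtype
      obtain ⟨a, ha⟩ := Submodule.mem_span_singleton.1 c.2
      have hz : (c : k) • z = 0 := by
        rw [← ha, smul_eq_mul, Algebra.smul_def, map_mul, hr, mul_zero, zero_mul]
      rw [map_zero, LinearMap.rTensor_tmul, Submodule.subtype_apply, ← mul_one (c : k),
        ← smul_eq_mul, TensorProduct.smul_tmul, hz, TensorProduct.tmul_zero]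
  have hN : Subsingleton N := Module.FaithfullyFlat.rTensor_reflects_triviality k Z _
  exact congrArg Subtype.val
    (Subsingleton.elim (⟨r, Submodule.mem_span_singleton_self r⟩ : N) 0)

/-- Faithfully flat descent for elements: over a faithfully flat algebra `Z`, the equality
`z ⊗ 1 = 1 ⊗ z` holds for scalars only. -/
theorem mem_bot_of_tmul_one_eq [Module.FaithfullyFlat k Z] {z : Z}
    (hz : z ⊗ₜ[k] (1 : Z) = 1 ⊗ₜ[k] z) : z ∈ (⊥ : Subalgebra k Z) := by
  let C : Submodule k Z := LinearMap.eqLocus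
    (Algebra.TensorProduct.includeLeft : Z →ₐ[k] Z ⊗[k] Z).toLinearMap
    (Algebra.TensorProduct.includeRight : Z →ₐ[k] Z ⊗[k] Z).toLinearMap
  have hC : ∀ c : C, (c : Z) ⊗ₜ[k] (1 : Z) = 1 ⊗ₜ[k] (c : Z) := fun c => c.2
  let e : C := ⟨1, rfl⟩
  -- By flatness this may be checked in Z ⊗ Z, where it is c ⊗ 1 = 1 ⊗ c multiplied by 1 ⊗ x. It
  -- shows that C ⊗ Z is generated by `e`, so (C / k e) ⊗ Z vanishes.
  have key : ∀ (c : C) (x : Z), c ⊗ₜ[k] x = e ⊗ₜ[k] ((c : Z) * x) := by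
    intro c x
    apply Module.Flat.rTensor_preserves_injective_linearMap (M := Z) C.subtype
      C.injective_subtype
    have := congrArg (fun t => t * ((1 : Z) ⊗ₜ[k] x)) (hC c)
    simpa [e] using this
  let N : Submodule k C := Submodule.span k {e}
  have hsub : Subsingleton ((C ⧸ N) ⊗[k] Z) := by
    refine subsingleton_of_forall_eq 0 fun t => ?_
    induction t with
    | zero => rfl
    | add a b ha hb => rw [ha, hb, add_zero]
    | tmul q x =>
      obtain ⟨c, rfl⟩ := N.mkQ_surjective q
      have h := congrArg (N.mkQ.rTensor Z) (key c x)
      have he : N.mkQ e = 0 := by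
        rw [Submodule.mkQ_apply, Submodule.Quotient.mk_eq_zero]
        exact Submodule.mem_span_singleton_self e
      rw [LinearMap.rTensor_tmul, LinearMap.rTensor_tmul, he, TensorProduct.zero_tmul] at h
      exact h
  have hq : Subsingleton (C ⧸ N) := Module.FaithfullyFlat.rTensor_reflects_triviality k Z _
  have hN : (⟨z, hz⟩ : C) ∈ N := by
    rw [← Submodule.Quotient.mk_eq_zero]
    exact Subsingleton.elim _ _
  obtain ⟨r, hr⟩ := Submodule.mem_span_singleton.1 hN
  rw [Algebra.mem_bot]
  refine ⟨r, ?_⟩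
  rw [Algebra.algebraMap_eq_smul_one]
  exact congrArg Subtype.val hr

/-- On a coinvariant z, the canonical map takes z ⊗ 1 and 1 ⊗ z to the same element 1 ⊗ z;
injectivity then reduces to descent. -/
theorem coinvariants_eq_bot [Bialgebra k H] [LeftComoduleAlgebra k H Z]
    [Module.FaithfullyFlat k Z] (h : Function.Injective (can k H Z)) :
    coinvariants k H Z = ⊥ := by
  refine le_antisymm (fun z hz => mem_bot_of_tmul_one_eq (h ?_)) bot_le
  have hz' : (coact z : H ⊗[k] Z) = 1 ⊗ₜ z := hz
  rw [can_tmul, can_tmul, hz', map_one, one_mul, Algebra.TensorProduct.tmul_mul_tmul, one_mul,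
    mul_one]

end LeftComoduleAlgebra

namespace BilinearForm

open LeftComoduleAlgebra MulOpposite

/-! ### The translation map B(E) → B(E, F) ⊗ B(E, F)ᵒᵖ. -/

section

variable {k : Type*} [CommRing k] {n m p : ℕ}

/-- Transposition reverses products over the opposite ring, so the relations of B(F, E) for w become
z w = 1 and w z = 1, conjugated by scalar matrices. For F = E this is the computation behind the
antipode. -/
theorem relations_opposite {E : GL (Fin n) k} {F : GL (Fin m) k} {A : Type*} [Ring A]
    [Algebra k A] {z : Matrix (Fin n) (Fin m) A} (h : Relations E F z) :
    Relations F E ((scal A (F⁻¹).val * z.transpose * scal A E.val).map op) := by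
  set w := scal A (F⁻¹).val * z.transpose * scal A E.val with hw
  have hwz : w * z = 1 := h.left
  have hzw : z * w = 1 := by
    rw [hw, ← Matrix.mul_assoc, ← Matrix.mul_assoc]; exact h.right
  have hwt : w.transpose = scal A E.val.transpose * (z * scal A (F⁻¹).val.transpose) := by
    rw [hw, transpose_mul_scal, transpose_scal_mul, Matrix.transpose_transpose]
  have e1 : w.map op = opT w.transpose := by simp [opT]
  have e2 : (w.map op).transpose = opT w := by simp [opT, Matrix.transpose_map]
  have e3 : ∀ {q : ℕ} (M : Matrix (Fin q) (Fin q) k),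
      scal Aᵐᵒᵖ M = opT (scal A M.transpose) := by
    intro q M; rw [opT_scal, Matrix.transpose_transpose]
  have i1 : ∀ {q : ℕ} (G : GL (Fin q) k),
      scal A (G⁻¹).val.transpose * scal A G.val.transpose = 1 := by
    intro q G
    rw [← scal_mul, ← Matrix.transpose_mul, ← Units.val_mul, mul_inv_cancel, Units.val_one,
      Matrix.transpose_one, scal_one]
  have i2 : ∀ {q : ℕ} (G : GL (Fin q) k),
      scal A G.val.transpose * scal A (G⁻¹).val.transpose = 1 := by
    intro q G
    rw [← scal_mul, ← Matrix.transpose_mul, ← Units.val_mul, inv_mul_cancel, Units.val_one,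
      Matrix.transpose_one, scal_one]
  constructor
  · rw [e2, e1, e3, e3, ← opT_mul, ← opT_mul, ← opT_mul, ← opT_one]
    congr 1
    calc w.transpose * (scal A F.val.transpose * (w * scal A (E⁻¹).val.transpose))
        = scal A E.val.transpose * (z * ((scal A (F⁻¹).val.transpose * scal A F.val.transpose)
            * (w * scal A (E⁻¹).val.transpose))) := by
          rw [hwt]; simp only [Matrix.mul_assoc]
      _ = scal A E.val.transpose * ((z * w) * scal A (E⁻¹).val.transpose) := by
          rw [i1, Matrix.one_mul, Matrix.mul_assoc z w]
      _ = 1 := by rw [hzw, Matrix.one_mul, i2]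
  · rw [e2, e1, e3, e3, ← opT_mul, ← opT_mul, ← opT_mul, ← opT_one]
    congr 1
    calc scal A F.val.transpose * (w * (scal A (E⁻¹).val.transpose * w.transpose))
        = scal A F.val.transpose * (w * ((scal A (E⁻¹).val.transpose * scal A E.val.transpose)
            * (z * scal A (F⁻¹).val.transpose))) := by
          rw [hwt]; simp only [Matrix.mul_assoc]
      _ = scal A F.val.transpose * ((w * z) * scal A (F⁻¹).val.transpose) := by
          rw [i1, Matrix.one_mul, Matrix.mul_assoc w z]
      _ = 1 := by rw [hwz, Matrix.one_mul, i2]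

/-- The inverse `F⁻¹ zᵗ E` of the matrix of generators of `B(E, F)`. -/
def genInv (E : GL (Fin n) k) (F : GL (Fin m) k) : Matrix (Fin m) (Fin n) (BAlg E F) :=
  scal (BAlg E F) (F⁻¹).val * (gen E F).transpose * scal (BAlg E F) E.val

theorem genInv_mul_gen (E : GL (Fin n) k) (F : GL (Fin m) k) : genInv E F * gen E F = 1 :=
  (gen_relations E F).left

theorem gen_mul_genInv (E : GL (Fin n) k) (F : GL (Fin m) k) : gen E F * genInv E F = 1 := by
  rw [genInv, ← Matrix.mul_assoc, ← Matrix.mul_assoc]; exact (gen_relations E F).right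

/-- The algebra morphism `B(F, E) → B(E, F)ᵒᵖ`, `z ↦ F⁻¹ zᵗ E`. -/
def oppositeHom (E : GL (Fin n) k) (F : GL (Fin m) k) : BAlg F E →ₐ[k] (BAlg E F)ᵐᵒᵖ :=
  BAlg.lift ((genInv E F).map op) (relations_opposite (gen_relations E F))

theorem oppositeHom_gen (E : GL (Fin n) k) (F : GL (Fin m) k) (i : Fin m) (j : Fin n) :
    oppositeHom E F (gen F E i j) = op (genInv E F i j) :=
  BAlg.lift_gen ((genInv E F).map op) (relations_opposite (gen_relations E F)) i j

/-- The algebra morphism `B(E) → B(E, F) ⊗ B(E, F)ᵒᵖ`, `h ↦ can⁻¹ (h ⊗ 1)`. -/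
def translation (E : GL (Fin n) k) (F : GL (Fin m) k) :
    BHopf E →ₐ[k] BAlg E F ⊗[k] (BAlg E F)ᵐᵒᵖ :=
  (Algebra.TensorProduct.map (AlgHom.id k (BAlg E F)) (oppositeHom E F)).comp (cocomp E F E)

theorem translation_gen (E : GL (Fin n) k) (F : GL (Fin m) k) (i j : Fin n) :
    translation E F (gen E E i j) = ∑ l, gen E F i l ⊗ₜ op (genInv E F l j) := by
  simp only [translation, AlgHom.comp_apply, cocomp_gen, map_sum,
    Algebra.TensorProduct.map_tmul, AlgHom.id_apply, oppositeHom_gen]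

end

/-! ### Multiplicativity up to contraction of the last two legs. -/

section

variable (k Z : Type*) [CommRing k] [Ring Z] [Algebra k Z]

instance instRingTensorOpTensor : Ring ((Z ⊗[k] Zᵐᵒᵖ) ⊗[k] Z) := inferInstance

/-- The linear map `(u ⊗ v) ⊗ x ↦ u ⊗ v x`. -/
def mulUnop : (Z ⊗[k] Zᵐᵒᵖ) ⊗[k] Z →ₗ[k] Z ⊗[k] Z :=
  (LinearMap.mul' k Z ∘ₗ (opLinearEquiv k).symm.toLinearMap.rTensor Z).lTensor Z ∘ₗ
    (TensorProduct.assoc k Z Zᵐᵒᵖ Z).toLinearMap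

variable {k Z}

@[simp]
theorem mulUnop_tmul (u v x : Z) :
    mulUnop k Z ((u ⊗ₜ op v) ⊗ₜ x) = u ⊗ₜ (v * x) := by
  simp [mulUnop]

/-- The contraction is not multiplicative, but right multiplication by a pure tensor descends along
it: the opposite product puts v to the left of the contracted factor and x to its right. -/
theorem mulUnop_mul_tmul (s : (Z ⊗[k] Zᵐᵒᵖ) ⊗[k] Z) (u v x : Z) :
    mulUnop k Z (s * ((u ⊗ₜ op v) ⊗ₜ x)) =
      TensorProduct.map (LinearMap.mulRight k u) (LinearMap.mulLeft k v ∘ₗ LinearMap.mulRight k x)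
        (mulUnop k Z s) := by
  induction s with
  | zero => simp
  | add a b ha hb => rw [add_mul, map_add, ha, hb, map_add, map_add]
  | tmul t y =>
    induction t with
    | zero => simp
    | add a b ha hb => rw [TensorProduct.add_tmul, add_mul, map_add, ha, hb, map_add, map_add]
    | tmul a b =>
      induction b using MulOpposite.rec'
      simp [← op_mul, mul_assoc]

/-- The substitute for multiplicativity: with 1 in the contracted leg of s, nothing separates v from
x. This allows induction on products of generators. -/
theorem mulUnop_mul {s : (Z ⊗[k] Zᵐᵒᵖ) ⊗[k] Z} {z : Z} (hs : mulUnop k Z s = z ⊗ₜ 1)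
    (t : (Z ⊗[k] Zᵐᵒᵖ) ⊗[k] Z) : mulUnop k Z (s * t) = (z ⊗ₜ 1) * mulUnop k Z t := by
  induction t with
  | zero => simp
  | add a b ha hb => rw [mul_add, map_add, ha, hb, map_add, mul_add]
  | tmul t x =>
    induction t with
    | zero => simp
    | add a b ha hb => rw [TensorProduct.add_tmul, mul_add, map_add, ha, hb, map_add, mul_add]
    | tmul u v =>
      induction v using MulOpposite.rec'
      rw [mulUnop_mul_tmul, hs]
      simp

/-- Right Z-linearity of the canonical map, which reduces its inversion to elements h ⊗ 1. -/
theorem can_mulUnop {H : Type*} [Ring H] [Bialgebra k H] [LeftComoduleAlgebra k H Z]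
    (t : Z ⊗[k] Zᵐᵒᵖ) (x : Z) : can k H Z (mulUnop k Z (t ⊗ₜ x)) =
      can k H Z (mulUnop k Z (t ⊗ₜ 1)) * (1 ⊗ₜ x) := by
  induction t with
  | zero => simp
  | add a b ha hb =>
    rw [TensorProduct.add_tmul, TensorProduct.add_tmul, map_add, map_add, ha, hb, map_add, map_add,
      add_mul]
  | tmul u v =>
    induction v using MulOpposite.rec'
    simp [can_tmul, mul_assoc]

/-- For t = u ⊗ v the left side is δ(u) (h ⊗ 1) (1 ⊗ v), and h ⊗ 1 commutes with 1 ⊗ v. -/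
theorem can_mulUnop_mul {H : Type*} [Ring H] [Bialgebra k H] [LeftComoduleAlgebra k H Z]
    (t : Z ⊗[k] Zᵐᵒᵖ) {s : Z ⊗[k] Zᵐᵒᵖ} {h : H}
    (hs : can k H Z (mulUnop k Z (s ⊗ₜ 1)) = h ⊗ₜ 1) :
    can k H Z (mulUnop k Z ((t * s) ⊗ₜ 1)) =
      can k H Z (mulUnop k Z (t ⊗ₜ 1)) * (h ⊗ₜ 1) := by
  have key : ∀ (u v : Z) (s : Z ⊗[k] Zᵐᵒᵖ),
      can k H Z (mulUnop k Z (((u ⊗ₜ op v) * s) ⊗ₜ 1)) =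
        coact u * can k H Z (mulUnop k Z (s ⊗ₜ 1)) * (1 ⊗ₜ v) := by
    intro u v s
    induction s with
    | zero => simp
    | add a b ha hb =>
      rw [mul_add, TensorProduct.add_tmul, TensorProduct.add_tmul, map_add, map_add, ha, hb,
        map_add, map_add, mul_add, add_mul]
    | tmul a b =>
      induction b using MulOpposite.rec'
      simp [can_tmul, ← op_mul, mul_assoc]
  induction t with
  | zero => simp
  | add a b ha hb =>
    rw [add_mul, TensorProduct.add_tmul, TensorProduct.add_tmul, map_add, map_add, ha, hb,
        map_add, map_add, add_mul]
  | tmul u v =>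
    induction v using MulOpposite.rec'
    rw [key, hs]
    simp [can_tmul, mul_assoc]

end

/-! ### Inverting the canonical map of B(E, F). -/

section

variable {k : Type*} [CommRing k] {n m p : ℕ}

theorem coact_eq (E : GL (Fin n) k) (F : GL (Fin m) k) :
    (coact : BAlg E F →ₐ[k] BHopf E ⊗[k] BAlg E F) = cocomp E E F := rfl

theorem can_translation (E : GL (Fin n) k) (F : GL (Fin m) k) (h : BHopf E) :
    can k (BHopf E) (BAlg E F) (mulUnop k _ (translation E F h ⊗ₜ 1)) = h ⊗ₜ 1 := by
  induction h using BAlg.induction with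
  | hs r =>
    rw [AlgHom.commutes, Algebra.algebraMap_eq_smul_one, Algebra.algebraMap_eq_smul_one,
      ← TensorProduct.smul_tmul', map_smul, map_smul, Algebra.TensorProduct.one_def, ← op_one,
      mulUnop_tmul, can_tmul, ← TensorProduct.smul_tmul', map_one, one_mul, one_mul]
  | hg i j =>
    have h := fun q => congrFun (congrFun (gen_mul_genInv E F) q) j
    simp only [Matrix.mul_apply] at h
    simp only [translation_gen, TensorProduct.sum_tmul, map_sum, mulUnop_tmul, mul_one, can_tmul,
      coact_eq, cocomp_gen, Finset.sum_mul, Algebra.TensorProduct.tmul_mul_tmul]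
    -- Summing first over the inner index exposes z w = 1 in the second leg.
    rw [Finset.sum_comm]
    simp only [← TensorProduct.tmul_sum, h]
    simp [Matrix.one_apply, TensorProduct.tmul_ite]
  | hm x y hx hy =>
    rw [map_mul, can_mulUnop_mul _ hy, hx, Algebra.TensorProduct.tmul_mul_tmul, mul_one]
  | ha x y hx hy =>
    rw [map_add, TensorProduct.add_tmul, map_add, map_add, hx, hy, TensorProduct.add_tmul]

/-- The inverse of the canonical map of `B(E, F)`. -/
def canInv (E : GL (Fin n) k) (F : GL (Fin m) k) :
    BHopf E ⊗[k] BAlg E F →ₗ[k] BAlg E F ⊗[k] BAlg E F :=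
  mulUnop k (BAlg E F) ∘ₗ
    (Algebra.TensorProduct.map (translation E F) (AlgHom.id k (BAlg E F))).toLinearMap

theorem canInv_apply (E : GL (Fin n) k) (F : GL (Fin m) k) (t : BHopf E ⊗[k] BAlg E F) :
    canInv E F t = mulUnop k (BAlg E F)
      (Algebra.TensorProduct.map (translation E F) (AlgHom.id k (BAlg E F)) t) := rfl

theorem canInv_cocomp (E : GL (Fin n) k) (F : GL (Fin m) k) (z : BAlg E F) :
    canInv E F (cocomp E E F z) = z ⊗ₜ 1 := by
  induction z using BAlg.induction with
  | hs r =>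
    rw [canInv_apply, AlgHom.commutes, AlgHom.commutes, Algebra.algebraMap_eq_smul_one,
      Algebra.algebraMap_eq_smul_one, map_smul, Algebra.TensorProduct.one_def,
      Algebra.TensorProduct.one_def, ← op_one, mulUnop_tmul, TensorProduct.smul_tmul', one_mul]
  | hg i j =>
    have h := fun q => congrFun (congrFun (genInv_mul_gen E F) q) j
    simp only [Matrix.mul_apply] at h
    simp only [canInv_apply, cocomp_gen, map_sum, Algebra.TensorProduct.map_tmul,
      translation_gen, TensorProduct.sum_tmul, mulUnop_tmul, AlgHom.id_apply]
    -- Here the inner sum is an entry of w z = 1.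
    rw [Finset.sum_comm]
    simp only [← TensorProduct.tmul_sum, h]
    simp [Matrix.one_apply, TensorProduct.tmul_ite]
  | hm x y hx hy =>
    rw [canInv_apply] at hx hy ⊢
    rw [map_mul, map_mul, mulUnop_mul hx, hy, Algebra.TensorProduct.tmul_mul_tmul, mul_one]
  | ha x y hx hy => rw [map_add, map_add, hx, hy, TensorProduct.add_tmul]

theorem can_bijective (E : GL (Fin n) k) (F : GL (Fin m) k) :
    Function.Bijective (can k (BHopf E) (BAlg E F)) := by
  refine Function.bijective_iff_has_inverse.2 ⟨canInv E F, fun t => ?_, fun t => ?_⟩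
  · induction t with
    | zero => simp
    | add a b ha hb => rw [map_add, map_add, ha, hb]
    | tmul z x =>
      have h := canInv_cocomp E F z
      rw [canInv_apply] at h
      rw [can_tmul, coact_eq, canInv_apply, map_mul, mulUnop_mul h]
      rw [Algebra.TensorProduct.map_tmul, map_one, Algebra.TensorProduct.one_def, ← op_one,
        mulUnop_tmul, Algebra.TensorProduct.tmul_mul_tmul, AlgHom.id_apply, mul_one, one_mul,
        one_mul]
  · induction t with
    | zero => simp
    | add a b ha hb => rw [map_add, map_add, ha, hb]
    | tmul h x =>
      rw [canInv_apply, Algebra.TensorProduct.map_tmul, AlgHom.id_apply, can_mulUnop,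
        can_translation, Algebra.TensorProduct.tmul_mul_tmul, mul_one, one_mul]

theorem isGaloisObject (E : GL (Fin n) k) (F : GL (Fin m) k)
    [Module.FaithfullyFlat k (BAlg E F)] : IsGaloisObject k (BHopf E) (BAlg E F) where
  coinvariants_eq := coinvariants_eq_bot (can_bijective E F).1
  can_bijective := can_bijective E F
  faithfullyFlat := inferInstance

/-! ### From isomorphisms to congruent matrices. -/

theorem scal_injective {A : Type*} [Ring A] [Algebra k A]
    (h : Function.Injective (algebraMap k A)) {p q : ℕ} :
    Function.Injective (scal A : Matrix (Fin p) (Fin q) k → Matrix (Fin p) (Fin q) A) :=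
  Matrix.map_injective h

/-- A matrix with columns on which `B(E)` coacts as on the columns of generators of `B(E, F)` is
obtained from the generators by a matrix of scalars. -/
theorem exists_eq_gen_mul_scal (E : GL (Fin n) k) (F : GL (Fin m) k)
    (hF : coinvariants k (BHopf E) (BAlg E F) = ⊥) (u : Matrix (Fin n) (Fin p) (BAlg E F))
    (hu : ∀ i j, cocomp E E F (u i j) = ∑ l, gen E E i l ⊗ₜ u l j) :
    ∃ P : Matrix (Fin m) (Fin p) k, u = gen E F * scal (BAlg E F) P := by
  let T := BHopf E ⊗[k] BAlg E F
  let iL : BHopf E →ₐ[k] BHopf E ⊗[k] BAlg E F := Algebra.TensorProduct.includeLeft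
  let iR : BAlg E F →ₐ[k] BHopf E ⊗[k] BAlg E F := Algebra.TensorProduct.includeRight
  have hcoact : ∀ {q : ℕ} (v : Matrix (Fin n) (Fin q) (BAlg E F)),
      (∀ i j, cocomp E E F (v i j) = ∑ l, gen E E i l ⊗ₜ v l j) →
        v.map (cocomp E E F) = (gen E E).map iL * v.map iR := by
    intro q v hv
    ext i j
    simp [hv, Matrix.mul_apply, iL, iR]
  -- In matrix form, δ(w u) = F⁻¹ zᵗ (aᵗ E a) u = F⁻¹ zᵗ E u = w u. Reversing the transpose of a z
  -- needs the entries of a and z to commute, which they do in separate tensor legs.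
  have hw : (genInv E F * u).map (cocomp E E F) = (genInv E F * u).map iR := by
    have hc : ∀ (i : Fin n) (j : Fin n) (l : Fin m),
        Commute ((gen E E).map iL i j) ((gen E F).map iR j l) :=
      fun i j l => by simp [Commute, SemiconjBy, iL, iR]
    rw [genInv, Matrix.map_mul, hcoact u hu, Matrix.map_mul, Matrix.map_mul, map_scal, map_scal,
      Matrix.transpose_map, hcoact _ (cocomp_gen E E F), transpose_mul_of_commute _ _ hc]
    have hE := ((gen_relations E E).map iL).transpose_mul_mul
    calc scal T (F⁻¹).val * (((gen E F).map iR).transpose * ((gen E E).map iL).transpose) *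
          scal T E.val * ((gen E E).map iL * u.map iR)
        = scal T (F⁻¹).val * ((gen E F).map iR).transpose *
          (((gen E E).map iL).transpose * scal T E.val * (gen E E).map iL) * u.map iR := by
          simp only [Matrix.mul_assoc]
      _ = (scal (BAlg E F) (F⁻¹).val * (gen E F).transpose * scal (BAlg E F) E.val * u).map
          iR := by
          rw [hE]
          simp only [Matrix.map_mul, map_scal, Matrix.transpose_map, T]
  have hmem : ∀ i j, ∃ r : k, algebraMap k (BAlg E F) r = (genInv E F * u) i j := by
    intro i j
    rw [← Set.mem_range, ← Algebra.mem_bot, ← hF]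
    exact congrFun (congrFun hw i) j
  choose P hP using hmem
  refine ⟨Matrix.of P, ?_⟩
  have : scal (BAlg E F) (Matrix.of P) = genInv E F * u := by
    ext i j
    exact hP i j
  rw [this, ← Matrix.mul_assoc, gen_mul_genInv, Matrix.one_mul]

theorem eq_of_gen_mul_scal {E : GL (Fin n) k} {F : GL (Fin m) k}
    (h : Function.Injective (algebraMap k (BAlg E F))) {P Q : Matrix (Fin m) (Fin p) k}
    (hPQ : gen E F * scal (BAlg E F) P = gen E F * scal (BAlg E F) Q) : P = Q := by
  apply scal_injective h
  have := congrArg (genInv E F * ·) hPQ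
  simpa only [← Matrix.mul_assoc, genInv_mul_gen, Matrix.one_mul] using this

theorem exists_map_gen_eq {E : GL (Fin n) k} {F : GL (Fin m) k} {G : GL (Fin p) k}
    (hF : coinvariants k (BHopf E) (BAlg E F) = ⊥) (φ : BAlg E G ≃ₐ[k] BAlg E F)
    (hφ : ∀ z, cocomp E E F (φ z) =
      Algebra.TensorProduct.map (AlgHom.id k (BHopf E)) φ.toAlgHom (cocomp E E G z)) :
    ∃ P : Matrix (Fin m) (Fin p) k, (gen E G).map φ = gen E F * scal (BAlg E F) P := by
  apply exists_eq_gen_mul_scal E F hF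
  intro i j
  rw [Matrix.map_apply, hφ]
  simp

theorem exists_of_isIsomorphic [Nontrivial k] {E : GL (Fin n) k} {F : GL (Fin m) k}
    {G : GL (Fin p) k} (hF : coinvariants k (BHopf E) (BAlg E F) = ⊥)
    (hG : coinvariants k (BHopf E) (BAlg E G) = ⊥)
    (iF : Function.Injective (algebraMap k (BAlg E F)))
    (iG : Function.Injective (algebraMap k (BAlg E G)))
    (h : IsIsomorphic k (BHopf E) (BAlg E G) (BAlg E F)) :
    ∃ h : p = m, ∃ P : GL (Fin p) k,
      G.val = P.val * F.val.submatrix (Fin.cast h) (Fin.cast h) * P.val.transpose := by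
  obtain ⟨φ, hφ⟩ := h
  obtain ⟨P, hP⟩ := exists_map_gen_eq hF φ hφ
  have hψ : ∀ z, cocomp E E G (φ.symm z) =
      Algebra.TensorProduct.map (AlgHom.id k (BHopf E)) φ.symm.toAlgHom (cocomp E E F z) := by
    intro z
    have := hφ (φ.symm z)
    rw [φ.apply_symm_apply] at this
    change cocomp E E F z = Algebra.TensorProduct.map (AlgHom.id k (BHopf E)) φ.toAlgHom
      (cocomp E E G (φ.symm z)) at this
    rw [this, ← AlgHom.comp_apply, ← Algebra.TensorProduct.map_comp]
    simp
  obtain ⟨Q, hQ⟩ := exists_map_gen_eq hG φ.symm hψ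
  -- Applying φ to φ⁻¹(z) = z' Q, with z' the generators of B(E, G), gives z = z P Q; left
  -- invertibility of z cancels it.
  have hPQ : P * Q = 1 := by
    apply eq_of_gen_mul_scal iF
    have := congrArg (fun M => M.map (φ : BAlg E G →ₐ[k] BAlg E F)) hQ
    rw [Matrix.map_mul, map_scal, Matrix.map_map] at this
    rw [scal_mul, ← Matrix.mul_assoc, ← hP, scal_one, Matrix.mul_one]
    refine this.symm.trans ?_
    ext i j
    simp
  have hQP : Q * P = 1 := by
    apply eq_of_gen_mul_scal iG
    have := congrArg (fun M => M.map (φ.symm : BAlg E F →ₐ[k] BAlg E G)) hP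
    rw [Matrix.map_mul, map_scal, Matrix.map_map] at this
    rw [scal_mul, ← Matrix.mul_assoc, ← hQ, scal_one, Matrix.mul_one]
    refine this.symm.trans ?_
    ext i j
    simp
  have hpm : p = m := by
    simpa using Matrix.square_of_invertible Q P hQP hPQ
  subst hpm
  -- The relations give G = Pᵗ F P, so the congruence matrix is Pᵗ.
  refine ⟨rfl, ⟨P.transpose, Q.transpose, ?_, ?_⟩, ?_⟩
  · rw [← Matrix.transpose_mul, hQP, Matrix.transpose_one]
  · rw [← Matrix.transpose_mul, hPQ, Matrix.transpose_one]
  · apply scal_injective iF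
    have hz : (gen E G).map (φ : BAlg E G →ₐ[k] BAlg E F) = gen E F * scal (BAlg E F) P := hP
    have := ((gen_relations E G).map (φ : BAlg E G →ₐ[k] BAlg E F)).transpose_mul_mul
    rw [hz, transpose_mul_scal] at this
    rw [← this]
    change _ = scal _ (P.transpose * F.val * P.transpose.transpose)
    rw [scal_mul, scal_mul, ← (gen_relations E F).transpose_mul_mul, Matrix.transpose_transpose]
    simp only [Matrix.mul_assoc]

/-! ### From congruent matrices to isomorphisms. -/

/-- The congruence says that Pᵗ is a k-point of B(F, G). It yields the left relation directly; the
right one follows since one-sided inverses of square matrices over k are two-sided. -/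
theorem relations_of_eq {F G : GL (Fin m) k} (P : Matrix (Fin m) (Fin m) k)
    (h : G.val = P * F.val * P.transpose) : Relations F G P.transpose := by
  have e : ∀ {q : ℕ} (M : Matrix (Fin q) (Fin q) k), scal k M = M := fun M => by ext; simp [scal]
  have h1 : (G⁻¹).val * P * F.val * P.transpose = 1 := by
    rw [Matrix.mul_assoc, Matrix.mul_assoc, ← Matrix.mul_assoc P, ← h, ← Units.val_mul,
      inv_mul_cancel, Units.val_one]
  constructor
  · rw [e, e, Matrix.transpose_transpose, h1]
  · rw [e, e, Matrix.transpose_transpose, Matrix.mul_assoc, Matrix.mul_assoc,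
      ← Matrix.mul_assoc (G⁻¹).val]
    exact mul_eq_one_comm.1 h1

/-- The algebra morphism `B(E, G) → B(E, F)`, `z ↦ z P`, of a matrix of scalars `P` satisfying the
relations of `B(F, G)`. -/
def genMulHom (E : GL (Fin n) k) {F : GL (Fin m) k} {G : GL (Fin p) k}
    {P : Matrix (Fin m) (Fin p) k} (h : Relations F G P) : BAlg E G →ₐ[k] BAlg E F :=
  BAlg.lift (gen E F * scal (BAlg E F) P) <|
    (gen_relations E F).mul (h.map (Algebra.ofId k (BAlg E F))) fun _ j l =>
      (Algebra.commutes (P j l) _).symm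

theorem map_genMulHom (E : GL (Fin n) k) {F : GL (Fin m) k} {G : GL (Fin p) k}
    {P : Matrix (Fin m) (Fin p) k} (h : Relations F G P) :
    (gen E G).map (genMulHom E h) = gen E F * scal (BAlg E F) P := by
  ext i j
  simp [genMulHom]

theorem genMulHom_gen (E : GL (Fin n) k) {F : GL (Fin m) k} {G : GL (Fin p) k}
    {P : Matrix (Fin m) (Fin p) k} (h : Relations F G P) (i : Fin n) (j : Fin p) :
    genMulHom E h (gen E G i j) = ∑ l, P l j • gen E F i l := by
  simp [genMulHom, Matrix.mul_apply, Algebra.smul_def, Algebra.commutes]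

theorem genMulHom_comp (E : GL (Fin n) k) {F : GL (Fin m) k} {G : GL (Fin p) k}
    {P : Matrix (Fin m) (Fin p) k} {Q : Matrix (Fin p) (Fin m) k} (hP : Relations F G P)
    (hQ : Relations G F Q) (h : Q * P = 1) :
    (genMulHom E hQ).comp (genMulHom E hP) = AlgHom.id k (BAlg E G) := by
  have key : ((gen E G).map (genMulHom E hP)).map (genMulHom E hQ) = gen E G := by
    rw [map_genMulHom, Matrix.map_mul, map_genMulHom, map_scal, Matrix.mul_assoc, ← scal_mul, h,
      scal_one, Matrix.mul_one]
  apply BAlg.hom_ext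
  intro i j
  exact congrFun (congrFun key i) j

theorem cocomp_genMulHom (E : GL (Fin n) k) {F : GL (Fin m) k} {G : GL (Fin p) k}
    {P : Matrix (Fin m) (Fin p) k} (h : Relations F G P) :
    (cocomp E E F).comp (genMulHom E h) =
      (Algebra.TensorProduct.map (AlgHom.id k (BHopf E)) (genMulHom E h)).comp
        (cocomp E E G) := by
  apply BAlg.hom_ext
  intro i j
  simp only [AlgHom.comp_apply, genMulHom_gen, map_sum, map_smul, cocomp_gen,
    Algebra.TensorProduct.map_tmul, AlgHom.id_apply, TensorProduct.tmul_sum,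
    TensorProduct.tmul_smul, Finset.smul_sum]
  exact Finset.sum_comm

theorem isIsomorphic_of_eq {E : GL (Fin n) k} {F G : GL (Fin m) k} (P : GL (Fin m) k)
    (h : G.val = P.val * F.val * P.val.transpose) :
    IsIsomorphic k (BHopf E) (BAlg E G) (BAlg E F) := by
  have h1 : (P⁻¹).val * P.val = 1 := by rw [← Units.val_mul, inv_mul_cancel, Units.val_one]
  have h2 : P.val * (P⁻¹).val = 1 := by rw [← Units.val_mul, mul_inv_cancel, Units.val_one]
  have h1' : P.val.transpose * (P⁻¹).val.transpose = 1 := by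
    rw [← Matrix.transpose_mul, h1, Matrix.transpose_one]
  have h2' : (P⁻¹).val.transpose * P.val.transpose = 1 := by
    rw [← Matrix.transpose_mul, h2, Matrix.transpose_one]
  have h' : F.val = (P⁻¹).val * G.val * (P⁻¹).val.transpose := by
    rw [h, Matrix.mul_assoc, Matrix.mul_assoc, Matrix.mul_assoc, h1', ← Matrix.mul_assoc, h1,
      Matrix.one_mul, Matrix.mul_one]
  have hP := relations_of_eq P.val h
  have hQ := relations_of_eq (P⁻¹).val h'
  exact ⟨AlgEquiv.ofAlgHom (genMulHom E hP) (genMulHom E hQ) (genMulHom_comp E hQ hP h1')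
    (genMulHom_comp E hP hQ h2'), fun z => DFunLike.congr_fun (cocomp_genMulHom E hP) z⟩

end

end BilinearForm

end

theorem theorem7 {k : Type*} [CommRing k] [IsDomain k] [IsPrincipalIdealRing k]
    {n m₁ m₂ : ℕ} (hn : 2 ≤ n) (hm₁ : 2 ≤ m₁) (hm₂ : 2 ≤ m₂)
    (E : GL (Fin n) k) (F₁ : GL (Fin m₁) k) (F₂ : GL (Fin m₂) k)
    (hF₁ : Module.FaithfullyFlat k (BilinearForm.BAlg E F₁))
    (hF₂ : Module.FaithfullyFlat k (BilinearForm.BAlg E F₂)) :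
    LeftComoduleAlgebra.IsGaloisObject k (BilinearForm.BHopf E) (BilinearForm.BAlg E F₁) ∧
    LeftComoduleAlgebra.IsGaloisObject k (BilinearForm.BHopf E) (BilinearForm.BAlg E F₂) ∧
    (LeftComoduleAlgebra.IsIsomorphic k (BilinearForm.BHopf E)
        (BilinearForm.BAlg E F₁) (BilinearForm.BAlg E F₂) ↔
      ∃ h : m₁ = m₂, ∃ P : GL (Fin m₁) k,
        F₁.val = P.val * F₂.val.submatrix (Fin.cast h) (Fin.cast h) * P.val.transpose) := by
  have h₁ := BilinearForm.isGaloisObject E F₁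
  have h₂ := BilinearForm.isGaloisObject E F₂
  refine ⟨h₁, h₂, BilinearForm.exists_of_isIsomorphic h₂.coinvariants_eq h₁.coinvariants_eq
    LeftComoduleAlgebra.algebraMap_injective_of_faithfullyFlat
    LeftComoduleAlgebra.algebraMap_injective_of_faithfullyFlat, ?_⟩
  -- Once m₁ and m₂ are identified, reindexing by `Fin.cast` is definitionally trivial.
  rintro ⟨rfl, P, hP⟩
  exact BilinearForm.isIsomorphic_of_eq P hP
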